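/- \textbf{Conventions.} Let $p$ be a prime and let $S$ be an $F$-finite regular domain of characteristic $p$ ($F$-finite: the Frobenius endomorphism $x\mapsto x^p$ is a finite ring homomorphism); $q$ denotes a power $p^e$, $e\ge 0$. For an ideal $\mathfrak a\subseteq S$ put $\mathfrak a^{[q]}=\langle f^q: f\in\mathfrak a\rangle$, and let $\mathfrak a^{[1/q]}$ be the smallest ideal $\mathfrak c$ with $\mathfrak a\subseteq\mathfrak c^{[q]}$. For $k\in\mathbb N$ with base $p$ expansion $k=k_0+k_1p+\cdots+k_rp^r$ put $\mathfrak a^{[k]}=\prod_i (\mathfrak a^{k_i})^{[p^i]}$, and put $\mathfrak a^{[k/q]}=(\mathfrak a^{[k]})^{[1/q]}$. For real $t\ge 0$ the Frobenius power of $\mathfrak a$ and the test ideal of $\mathfrak a$ with exponent $t$ are the ascending unions $$\mathfrak a^{[t]}=\bigcup_{e\ge 0}\mathfrak a^{[\lceil p^et\rceil/p^e]},\qquad \tau(\mathfrak a^t)=\bigcup_{e\ge 0}\bigl(\mathfrak a^{\lceil p^et\rceil}\bigr)^{[1/p^e]}.$$ For a nonzero ideal $\mathfrak a$, the least critical exponent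 and the $F$-pure threshold are $$\operatorname{lce}(\mathfrak a)=\sup\{t>0:\mathfrak a^{[t]}=S\},\qquad \operatorname{fpt}(\mathfrak a)=\sup\{t>0:\tau(\mathfrak a^t)=S\}$$ in $[0,\infty]$. For $G\in S$ write $\tau(G^t)=\tau(\langle G\rangle^t)$ and $\operatorname{fpt}(G)=\operatorname{fpt}(\langle G\rangle)$. \textbf{Statement.} (1) Let $R$ be an $F$-finite regular domain of characteristic $p$, let $\mathfrak a=\langle g_1,\dots,g_m\rangle$ be a nonzero proper ideal of $R$, let $z=z_1,\dots,z_m$ be variables over $R$, and let $G=z_1g_1+\cdots+z_mg_m\in R[z]$. Then $\operatorname{lce}(\mathfrak a)=\operatorname{fpt}(G)$. (2) If moreover $\Bbbk$ is an $F$-finite field contained in $R$, then also $\operatorname{lce}(\mathfrak a)=\operatorname{fpt}(G)$ when $G$ is regarded as an element of $R\otimes_{\Bbbk}\Bbbk(z)$ and its $F$-pure threshold is computed in that ring. (3) Let $\Bbbk$ be an $F$-finite field of characteristic $p$, let $\mathfrak a=\langle g_1,\dots,g_m\rangle$ be an ideal of $\Bbbk[x]=\Bbbk[x_1,\dots,x_n]$,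 and let $G=z_1g_1+\cdots+z_mg_m\in\Bbbk(z)[x]$. If $0<t<1$, then $\tau(G^t)=\mathfrak a^{[t]}\cdot\Bbbk(z)[x]$ and $\mathfrak a^{[t]}=\tau(G^t)\cap\Bbbk[x]$. If $\mathfrak a$ is nonzero and proper, then $\operatorname{fpt}(G)=\operatorname{lce}(\mathfrak a)$. -/

import Mathlib

open scoped NNReal ENNReal TensorProduct

/-- A commutative ring of prime characteristic `p` is *`F`-finite* if its Frobenius endomorphism
`x ↦ x ^ p` is a finite ring homomorphism. -/
def IsFFinite (p : ℕ) (R : Type*) [CommRing R] [ExpChar R p] : Prop :=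
  (frobenius R p).Finite

namespace Ideal

variable {R : Type*} [CommRing R]

/-- The standard Frobenius power `𝔞^[q]`, for `q` a power of the characteristic: the ideal
generated by all `f ^ q` with `f ∈ 𝔞`. -/
def bracketPow (𝔞 : Ideal R) (q : ℕ) : Ideal R :=
  Ideal.span ((fun f : R => f ^ q) '' (𝔞 : Set R))

/-- The Frobenius root `𝔞^[1/q]`, for `q` a power of the characteristic: the smallest ideal `𝔠`
with `𝔞 ⊆ 𝔠^[q]`. In an `F`-finite regular ring the family of all such `𝔠` has a smallest member,
which is then the intersection of the family. -/
def bracketRoot (𝔞 : Ideal R) (q : ℕ) : Ideal R :=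
  sInf {𝔠 : Ideal R | 𝔞 ≤ 𝔠.bracketPow q}

/-- The integral Frobenius power `𝔞^[k]`: if `k = k₀ + k₁ p + ⋯ + kᵣ p ^ r` is the base `p`
expansion of `k`, this is the product of the ideals `(𝔞 ^ kᵢ)^[p ^ i]`. -/
def frobeniusPowNat (p : ℕ) (𝔞 : Ideal R) (k : ℕ) : Ideal R :=
  ∏ i ∈ Finset.range (Nat.digits p k).length,
    (𝔞 ^ (Nat.digits p k).getD i 0).bracketPow (p ^ i)

/-- The Frobenius power `𝔞^[k / p ^ e] = (𝔞^[k])^[1 / p ^ e]`. -/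
def frobeniusPowRat (p : ℕ) (𝔞 : Ideal R) (k e : ℕ) : Ideal R :=
  (𝔞.frobeniusPowNat p k).bracketRoot (p ^ e)

/-- The real Frobenius power `𝔞^[t]`, for `t ≥ 0`: the union of the ascending chain of the
`𝔞^[tₑ]`, where `tₑ = ⌈p ^ e t⌉ / p ^ e` decreases to `t`. -/
noncomputable def frobeniusPow (p : ℕ) (𝔞 : Ideal R) (t : ℝ≥0) : Ideal R :=
  ⨆ e : ℕ, 𝔞.frobeniusPowRat p ⌈(p : ℝ≥0) ^ e * t⌉₊ e

/-- The test ideal `τ(𝔞 ^ t)`, for `t ≥ 0`, in the form valid in an `F`-finite regular ring: the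
union of the ascending chain of the ideals `(𝔞 ^ ⌈p ^ e t⌉)^[1 / p ^ e]`. -/
noncomputable def testIdeal (p : ℕ) (𝔞 : Ideal R) (t : ℝ≥0) : Ideal R :=
  ⨆ e : ℕ, (𝔞 ^ ⌈(p : ℝ≥0) ^ e * t⌉₊).bracketRoot (p ^ e)

/-- The `F`-pure threshold: the supremum, in `[0, ∞]`, of all `t > 0` with `τ(𝔞 ^ t) = R`. -/
noncomputable def fpt (p : ℕ) (𝔞 : Ideal R) : ℝ≥0∞ :=
  sSup ((fun t : ℝ≥0 => (t : ℝ≥0∞)) '' {t : ℝ≥0 | 0 < t ∧ 𝔞.testIdeal p t = ⊤})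

/-- The least critical exponent: the supremum, in `[0, ∞]`, of all `t > 0` with `𝔞^[t] = R`. -/
noncomputable def lce (p : ℕ) (𝔞 : Ideal R) : ℝ≥0∞ :=
  sSup ((fun t : ℝ≥0 => (t : ℝ≥0∞)) '' {t : ℝ≥0 | 0 < t ∧ 𝔞.frobeniusPow p t = ⊤})

end Ideal

/-- The field `k(z) = k(z₁, …, zₘ)` of rational functions. -/
abbrev RatFunField (m : ℕ) (k : Type*) [Field k] : Type _ :=
  FractionRing (MvPolynomial (Fin m) k)

/-- The variable `zᵢ` of `k(z)`. -/
noncomputable def ratVar (k : Type*) [Field k] {m : ℕ} (i : Fin m) : RatFunField m k :=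
  algebraMap (MvPolynomial (Fin m) k) (RatFunField m k) (MvPolynomial.X i)

/-- The generic linear combination `z₁ g₁ + ⋯ + zₘ gₘ` in `R[z₁, …, zₘ]`. -/
noncomputable def genericComb {R : Type*} [CommRing R] {m : ℕ} (g : Fin m → R) :
    MvPolynomial (Fin m) R :=
  ∑ i, MvPolynomial.X i * MvPolynomial.C (g i)

/-- The generic linear combination `z₁ g₁ + ⋯ + zₘ gₘ` in `R ⊗ₖ k(z₁, …, zₘ)`. -/
noncomputable def genericCombTensor (k : Type*) [Field k] {R : Type*} [CommRing R] [Algebra k R]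
    {m : ℕ} (g : Fin m → R) : R ⊗[k] RatFunField m k :=
  ∑ i, g i ⊗ₜ[k] ratVar k i

/-- The inclusion `k[x₁, …, xₙ] → k(z₁, …, zₘ)[x₁, …, xₙ]`. -/
noncomputable def polyIncl (k : Type*) [Field k] (m n : ℕ) :
    MvPolynomial (Fin n) k →+* MvPolynomial (Fin n) (RatFunField m k) :=
  MvPolynomial.map (algebraMap k (RatFunField m k))

/-- The generic linear combination `z₁ g₁ + ⋯ + zₘ gₘ` in `k(z₁, …, zₘ)[x₁, …, xₙ]`. -/
noncomputable def genericCombPoly {k : Type*} [Field k] {m n : ℕ}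
    (g : Fin m → MvPolynomial (Fin n) k) : MvPolynomial (Fin n) (RatFunField m k) :=
  ∑ i, MvPolynomial.C (ratVar k i) * polyIncl k m n (g i)

/-!
Let `G` be the generic linear combination of the generators of `𝔞`. The coefficients of `G ^ k`
generate exactly `𝔞^[k]`: the multinomial coefficients occurring in `G ^ i` are prime to `p` for
`i < p`, and writing `k` in base `p` turns `G ^ k` into a product of powers `(G ^ kᵢ) ^ (p ^ i)`
whose monomials do not interfere with each other.

If `R` is regular, then the powers of a regular system of parameters of a localization of `R` still
form a regular sequence, so the Frobenius endomorphism of `R` is flat (Kunz). Being finite as well,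
it makes `R` projective over itself, and dual bases reduce the computation of Frobenius roots to
applying `p⁻ᵉ`-linear maps `R → R`. For `k < p ^ e` every exponent in `G ^ k` is less than `p ^ e`,
so those maps act on `G ^ k` coefficient by coefficient. Thus the `p ^ e`-th Frobenius root of
`G ^ k` is extended from that of `𝔞^[k]`, in `R[z]` as well as in its localizations, which include
`R ⊗ₖ k(z)` and `k(z)[x]`. Hence `τ(G ^ t)` is extended from `𝔞^[t]` for `t < 1`, while for
`t ≥ 1` both ideals are proper, being contained in `⟨G⟩` and in `𝔞`, respectively.
-/

section RegularLocalRings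

open IsLocalRing RingTheory.Sequence Pointwise

section Quotient

variable {A : Type*} [CommRing A]

theorem map_mk_span_insert (x : A) (s : Set A) :
    (Ideal.span (insert x s)).map (Ideal.Quotient.mk (Ideal.span {x})) =
      Ideal.span (Ideal.Quotient.mk (Ideal.span {x}) '' s) := by
  rw [Ideal.span_insert, Ideal.map_sup, Ideal.map_quotient_self, bot_sup_eq, Ideal.map_span]

theorem isWeaklyRegular_map_mk_iff (x : A) (rs : List A) :
    IsWeaklyRegular (A ⧸ Ideal.span {x}) (rs.map (Ideal.Quotient.mk (Ideal.span {x}))) ↔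
      IsWeaklyRegular (QuotSMulTop x A) rs := by
  rw [← Ideal.Quotient.algebraMap_eq, isWeaklyRegular_map_algebraMap_iff]
  refine (Submodule.quotEquivOfEq _ _ ?_).isWeaklyRegular_congr rs
  rw [← Submodule.ideal_span_singleton_smul, smul_eq_mul, Ideal.mul_top]

variable [IsLocalRing A]

theorem isLocalRing_quotient {I : Ideal A} (hI : I ≤ maximalIdeal A) : IsLocalRing (A ⧸ I) :=
  have : Nontrivial (A ⧸ I) :=
    Ideal.Quotient.nontrivial_iff.2 (ne_top_of_le_ne_top (maximalIdeal.isMaximal A).ne_top hI)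
  .of_surjective' (Ideal.Quotient.mk I) Ideal.Quotient.mk_surjective

theorem ofList_map_mk_eq_maximalIdeal_iff {x : A} [IsLocalRing (A ⧸ Ideal.span {x})]
    (hx : x ∈ maximalIdeal A) {rs : List A} :
    Ideal.ofList (rs.map (Ideal.Quotient.mk (Ideal.span {x}))) =
      maximalIdeal (A ⧸ Ideal.span {x}) ↔ Ideal.ofList (x :: rs) = maximalIdeal A := by
  rw [← Ideal.map_ofList, ← map_maximalIdeal_of_surjective (Ideal.Quotient.mk (Ideal.span {x}))
    Ideal.Quotient.mk_surjective, Ideal.map_eq_iff_sup_ker_eq_of_surjective _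
    Ideal.Quotient.mk_surjective, Ideal.mk_ker, Ideal.ofList_cons, sup_comm,
    sup_eq_left.2 ((Ideal.span_singleton_le_iff_mem _).2 hx)]

theorem eq_bot_of_le_mul_self [IsNoetherianRing A] {I J : Ideal A} (hI : I ≤ maximalIdeal A)
    (hJ : J ≤ I * J) : J = ⊥ :=
  Submodule.eq_bot_of_le_smul_of_le_jacobson_bot I J J.fg_of_isNoetherianRing hJ
    (hI.trans (IsLocalRing.maximalIdeal_le_jacobson _))

variable [IsNoetherianRing A] {x : A}

/-- Some coefficient of `x` in terms of a minimal generating set is a unit, so that `x` can be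
exchanged for the corresponding generator. -/
theorem exists_span_insert_eq_maximalIdeal (hx : x ∈ maximalIdeal A)
    (hx2 : x ∉ maximalIdeal A ^ 2) :
    ∃ s : Finset A, s.card + 1 = (maximalIdeal A).spanFinrank ∧
      Ideal.span (insert x (s : Set A)) = maximalIdeal A := by
  classical
  obtain ⟨S, hcard, hS⟩ := Submodule.FG.exists_span_finset_card_eq_spanFinrank
    (maximalIdeal A).fg_of_isNoetherianRing
  have hSm (s : A) (hs : s ∈ S) : s ∈ maximalIdeal A := hS ▸ Submodule.subset_span hs
  obtain ⟨a, -, hxa⟩ := Submodule.mem_span_finset.1 (hS.symm ▸ hx)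
  obtain ⟨y, hyS, hay⟩ : ∃ y ∈ S, IsUnit (a y) := by
    by_contra! hunit
    refine hx2 (hxa ▸ pow_two (maximalIdeal A) ▸ Ideal.sum_mem _ fun y hy => ?_)
    exact Ideal.mul_mem_mul ((mem_maximalIdeal _).2 (hunit y hy)) (hSm y hy)
  refine ⟨S.erase y, by rw [Finset.card_erase_add_one hyS, hcard], le_antisymm ?_ ?_⟩
  · rw [Ideal.span_le, Set.insert_subset_iff]
    exact ⟨hx, fun s hs => hSm s (Finset.mem_of_mem_erase hs)⟩
  · set J := Ideal.span (insert x (S.erase y : Set A)) with hJ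
    have herase (s : A) (hs : s ∈ S.erase y) : s ∈ J :=
      Ideal.subset_span (Set.mem_insert_of_mem _ hs)
    have hyJ : y ∈ J := by
      rw [← Ideal.unit_mul_mem_iff_mem _ hay, ← smul_eq_mul,
        eq_sub_of_add_eq ((Finset.add_sum_erase S (fun s => a s • s) hyS).trans hxa)]
      exact sub_mem (Ideal.subset_span (Set.mem_insert _ _))
        (Ideal.sum_mem _ fun s hs => Ideal.mul_mem_left _ _ (herase s hs))
    rw [← hS, Submodule.span_le]
    intro s hs
    obtain rfl | hsy := eq_or_ne s y
    · exact hyJ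
    · exact herase s (Finset.mem_erase.2 ⟨hsy, hs⟩)

theorem spanFinrank_maximalIdeal_quotient_add_one_le [IsLocalRing (A ⧸ Ideal.span {x})]
    (hx : x ∈ maximalIdeal A) (hx2 : x ∉ maximalIdeal A ^ 2) :
    (maximalIdeal (A ⧸ Ideal.span {x})).spanFinrank + 1 ≤ (maximalIdeal A).spanFinrank := by
  classical
  obtain ⟨s, hcard, hs⟩ := exists_span_insert_eq_maximalIdeal hx hx2
  rw [← hcard, ← map_maximalIdeal_of_surjective (Ideal.Quotient.mk (Ideal.span {x}))
    Ideal.Quotient.mk_surjective, ← hs, map_mk_span_insert]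
  gcongr
  exact (Submodule.spanFinrank_span_le_ncard_of_finite (s.finite_toSet.image _)).trans
    ((Set.ncard_image_le s.finite_toSet).trans (Set.ncard_coe_finset s).le)

end Quotient

section RegularLocalRing

theorem exists_mem_maximalIdeal_notMem_minimalPrimes {A : Type*} [CommRing A] [IsLocalRing A]
    [IsNoetherianRing A] (hA : maximalIdeal A ∉ minimalPrimes A) :
    ∃ x ∈ maximalIdeal A, x ∉ maximalIdeal A ^ 2 ∧ ∀ Q ∈ minimalPrimes A, x ∉ Q := by
  have hunion : ¬ (maximalIdeal A : Set A) ⊆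
      ⋃ I ∈ insert (maximalIdeal A ^ 2) (minimalPrimes A), (I : Set A) := by
    rw [Ideal.subset_union_prime_finite
      ((minimalPrimes.finite_of_isNoetherianRing A).insert _) (maximalIdeal A ^ 2)
      (maximalIdeal A ^ 2) fun I hI hne _ => ((Set.mem_insert_iff.1 hI).resolve_left hne).1.1]
    rintro ⟨I, rfl | hI, hle⟩
    · have hbot : maximalIdeal A = ⊥ :=
        eq_bot_of_le_mul_self le_rfl (pow_two (maximalIdeal A) ▸ hle)
      exact hA ⟨⟨inferInstance, bot_le⟩, fun Q _ _ => hbot.trans_le bot_le⟩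
    · exact hA ((maximalIdeal.isMaximal A).eq_of_le hI.1.1.ne_top hle ▸ hI)
  obtain ⟨x, hxm, hx⟩ := Set.not_subset.1 hunion
  simp only [Set.mem_iUnion, not_exists, SetLike.mem_coe] at hx
  exact ⟨x, hxm, hx _ (Set.mem_insert _ _), fun Q hQ => hx Q (Set.mem_insert_of_mem _ hQ)⟩

theorem isDomain_of_isPrime_span_singleton {A : Type*} [CommRing A] [IsLocalRing A]
    [IsNoetherianRing A] {x : A} (hxm : x ∈ maximalIdeal A) (hx : (Ideal.span {x}).IsPrime)
    (hmin : ∀ Q ∈ minimalPrimes A, x ∉ Q) : IsDomain A := by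
  obtain ⟨Q, hQ, hQx⟩ := Ideal.exists_minimalPrimes_le (bot_le : (⊥ : Ideal A) ≤ Ideal.span {x})
  have hQprime : Q.IsPrime := hQ.1.1
  have hQmul : Q ≤ Ideal.span {x} * Q := by
    intro y hy
    obtain ⟨z, rfl⟩ := Ideal.mem_span_singleton.1 (hQx hy)
    exact Ideal.mul_mem_mul (Ideal.mem_span_singleton_self x)
      ((hQprime.mem_or_mem hy).resolve_left (hmin Q hQ))
  have hQbot : Q = ⊥ := eq_bot_of_le_mul_self ((Ideal.span_singleton_le_iff_mem _).2 hxm) hQmul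
  have : (⊥ : Ideal A).IsPrime := hQbot ▸ hQprime
  exact IsDomain.of_bot_isPrime A

variable {A : Type*} [CommRing A] [IsRegularLocalRing A] {x : A}

theorem spanFinrank_maximalIdeal_le_ringKrullDim_quotient_add_one (hx : x ∈ maximalIdeal A) :
    ((maximalIdeal A).spanFinrank : WithBot ℕ∞) ≤ ringKrullDim (A ⧸ Ideal.span {x}) + 1 := by
  rw [(isRegularLocalRing_iff A).1 ‹_›, ← maximalIdeal_height_eq_ringKrullDim]
  exact Ideal.height_le_ringKrullDim_quotient_add_one hx

theorem spanFinrank_maximalIdeal_quotient_add_one [IsLocalRing (A ⧸ Ideal.span {x})]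
    (hx : x ∈ maximalIdeal A) (hx2 : x ∉ maximalIdeal A ^ 2) :
    (maximalIdeal (A ⧸ Ideal.span {x})).spanFinrank + 1 = (maximalIdeal A).spanFinrank := by
  refine (spanFinrank_maximalIdeal_quotient_add_one_le hx hx2).antisymm ?_
  exact_mod_cast (spanFinrank_maximalIdeal_le_ringKrullDim_quotient_add_one hx).trans
    (add_le_add_left (ringKrullDim_le_spanFinrank_maximalIdeal (A ⧸ Ideal.span {x})) 1)

theorem isRegularLocalRing_quotient_span_singleton (hx : x ∈ maximalIdeal A)
    (hx2 : x ∉ maximalIdeal A ^ 2) : IsRegularLocalRing (A ⧸ Ideal.span {x}) := by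
  have := isLocalRing_quotient ((Ideal.span_singleton_le_iff_mem _).2 hx)
  have hdim := spanFinrank_maximalIdeal_le_ringKrullDim_quotient_add_one hx
  rw [← spanFinrank_maximalIdeal_quotient_add_one hx hx2, Nat.cast_add, Nat.cast_one] at hdim
  exact .of_spanFinrank_maximalIdeal_le _ (ENat.WithBot.add_le_add_one_right_iff.1 hdim)

variable (A)

theorem maximalIdeal_notMem_minimalPrimes (hA : (maximalIdeal A).spanFinrank ≠ 0) :
    maximalIdeal A ∉ minimalPrimes A := by
  intro hmin
  have hdim := (isRegularLocalRing_iff A).1 ‹_›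
  rw [← maximalIdeal_height_eq_ringKrullDim, Ideal.height_eq_zero_iff.2 hmin] at hdim
  exact hA (by exact_mod_cast hdim)

/-- Induction on the dimension: an element `x` outside `m²` and outside all minimal primes
generates a prime ideal, which then has to contain a minimal prime equal to zero. -/
theorem isDomain_of_isRegularLocalRing : IsDomain A := by
  induction hn : (maximalIdeal A).spanFinrank generalizing A with
  | zero =>
    exact (isField_iff_maximalIdeal_eq.2 ((Submodule.spanFinrank_eq_zero_iff_eq_bot
      (maximalIdeal A).fg_of_isNoetherianRing).1 hn)).isDomain
  | succ n ih =>
    obtain ⟨x, hxm, hx2, hmin⟩ := exists_mem_maximalIdeal_notMem_minimalPrimes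
      (maximalIdeal_notMem_minimalPrimes A (by omega))
    have := isRegularLocalRing_quotient_span_singleton hxm hx2
    have := ih (A ⧸ Ideal.span {x}) (by
      have := spanFinrank_maximalIdeal_quotient_add_one hxm hx2
      omega)
    exact isDomain_of_isPrime_span_singleton hxm
      ((Ideal.Quotient.isDomain_iff_prime _).1 this) hmin

theorem exists_ofList_eq_maximalIdeal_isWeaklyRegular :
    ∃ rs : List A, Ideal.ofList rs = maximalIdeal A ∧ IsWeaklyRegular A rs := by
  induction hn : (maximalIdeal A).spanFinrank generalizing A with
  | zero =>
    refine ⟨[], ?_, .nil A A⟩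
    rw [Ideal.ofList_nil, (Submodule.spanFinrank_eq_zero_iff_eq_bot
      (maximalIdeal A).fg_of_isNoetherianRing).1 hn]
  | succ n ih =>
    have := isDomain_of_isRegularLocalRing A
    obtain ⟨x, hxm, hx2, -⟩ := exists_mem_maximalIdeal_notMem_minimalPrimes
      (maximalIdeal_notMem_minimalPrimes A (by omega))
    have := isRegularLocalRing_quotient_span_singleton hxm hx2
    obtain ⟨rs', hspan, hreg⟩ := ih (A ⧸ Ideal.span {x}) (by
      have := spanFinrank_maximalIdeal_quotient_add_one hxm hx2
      omega)
    obtain ⟨rs, rfl⟩ : ∃ rs : List A, rs.map (Ideal.Quotient.mk (Ideal.span {x})) = rs' :=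
      List.map_surjective_iff.2 Ideal.Quotient.mk_surjective rs'
    exact ⟨x :: rs, (ofList_map_mk_eq_maximalIdeal_iff hxm).1 hspan,
      .cons (IsSMulRegular.of_ne_zero fun h => hx2 (h ▸ zero_mem _))
        ((isWeaklyRegular_map_mk_iff x rs).1 hreg)⟩

end RegularLocalRing

section WeaklyRegular

variable {A : Type*} [CommRing A] [hA : IsLocalRing A]

/-- Weakly regular sequences in a local ring may be permuted, so that each entry can be moved to
the end before it is raised to a power. -/
theorem isWeaklyRegular_map_pow {M : Type*} [AddCommGroup M] [Module A M] [hM : IsNoetherian A M]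
    {rs : List A} (hrs : IsWeaklyRegular M rs) (hm : ∀ r ∈ rs, r ∈ maximalIdeal A) {n : ℕ}
    (hn : n ≠ 0) : IsWeaklyRegular M (rs.map (· ^ n)) := by
  induction hrs generalizing hM with
  | nil => exact .nil A _
  | @cons M _ _ x rs hx _ ih =>
    obtain ⟨hxm, hm⟩ := List.forall_mem_cons.1 hm
    have hpow : ∀ y ∈ rs.map (· ^ n), y ∈ maximalIdeal A := List.forall_mem_map.2 fun y hy =>
      Ideal.pow_mem_of_mem _ (hm y hy) n (Nat.pos_of_ne_zero hn)
    have hlast : IsWeaklyRegular M (rs.map (· ^ n) ++ [x]) :=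
      isWeaklyRegular_of_perm_of_subset_maximalIdeal (.cons hx (ih hm))
        (List.perm_append_singleton _ _).symm (List.forall_mem_cons.2 ⟨hxm, hpow⟩)
    rw [isWeaklyRegular_append_iff, isWeaklyRegular_singleton_iff] at hlast
    have hlast_pow : IsWeaklyRegular M (rs.map (· ^ n) ++ [x ^ n]) := by
      rw [isWeaklyRegular_append_iff, isWeaklyRegular_singleton_iff]
      exact ⟨hlast.1, hlast.2.pow n⟩
    refine isWeaklyRegular_of_perm_of_subset_maximalIdeal hlast_pow
      (List.perm_append_singleton _ _) ?_
    rw [List.forall_mem_append, List.forall_mem_singleton]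
    exact ⟨hpow, Ideal.pow_mem_of_mem _ hxm n (Nat.pos_of_ne_zero hn)⟩

theorem free_of_isWeaklyRegular [hN : IsNoetherianRing A] {M : Type*}
    [AddCommGroup M] [Module A M] [hM : Module.Finite A M] {rs : List A}
    (hrs : IsWeaklyRegular M rs) (hspan : Ideal.ofList rs = maximalIdeal A) :
    Module.Free A M := by
  induction hrs using IsWeaklyRegular.recIterModByRegularWithRing generalizing hA hN hM with
  | @nil A _ M _ _ =>
    let _ := (isField_iff_maximalIdeal_eq.2 (hspan.symm.trans Ideal.ofList_nil)).toField
    infer_instance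
  | @cons A _ M _ _ x rs hx _ ih =>
    have hxm : x ∈ maximalIdeal A := hspan ▸ Ideal.subset_span List.mem_cons_self
    have := isLocalRing_quotient ((Ideal.span_singleton_le_iff_mem _).2 hxm)
    have := Module.finitePresentation_of_finite A M
    have := Module.Finite.of_restrictScalars_finite A (A ⧸ Ideal.span {x}) (QuotSMulTop x M)
    rw [← Module.free_quotSMulTop_iff_free A M (maximalIdeal_le_jacobson _ hxm) hx]
    exact ih ((ofList_map_mk_eq_maximalIdeal_iff hxm).2 hspan)

end WeaklyRegular

end RegularLocalRings

section Frobenius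

open IsLocalRing RingTheory.Sequence

theorem flat_of_isWeaklyRegular_map {A B : Type*} [CommRing A] [IsLocalRing A]
    [IsNoetherianRing A] [CommRing B] {f : A →+* B} (hf : f.Finite) {rs : List A}
    (hspan : Ideal.ofList rs = maximalIdeal A) (hrs : IsWeaklyRegular B (rs.map f)) : f.Flat := by
  algebraize [f]
  have := free_of_isWeaklyRegular ((isWeaklyRegular_map_algebraMap_iff B B rs).1 hrs) hspan
  exact (inferInstance : Module.Flat A B)

theorem flat_frobenius_of_isRegularLocalRing (p : ℕ) {A : Type*} [CommRing A]
    [IsRegularLocalRing A] [ExpChar A p] (hA : IsFFinite p A) : (frobenius A p).Flat := by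
  obtain ⟨rs, hspan, hrs⟩ := exists_ofList_eq_maximalIdeal_isWeaklyRegular A
  exact flat_of_isWeaklyRegular_map hA hspan (isWeaklyRegular_map_pow hrs
    (fun r hr => hspan ▸ Ideal.subset_span hr) (expChar_pos A p).ne')

theorem isFFinite_of_isLocalization.{u} {p : ℕ} {R T : Type u} [CommRing R] [ExpChar R p]
    [CommRing T] [ExpChar T p] [Algebra R T] (W : Submonoid R) [IsLocalization W T]
    (hR : IsFFinite p R) : IsFFinite p T := by
  have hdvd : ∀ w ∈ W, ∃ v ∈ W.map (frobenius R p), w ∣ v := fun w hw =>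
    ⟨w ^ p, ⟨w, hw, rfl⟩, dvd_pow_self w (expChar_pos R p).ne'⟩
  have hle : W.map (frobenius R p) ≤ W := by
    rintro _ ⟨w, hw, rfl⟩
    exact W.pow_mem hw p
  have := (IsLocalization.iff_of_le_of_exists_dvd (S := T) _ W hle hdvd).2 ‹_›
  have hmap : IsLocalization.map T (frobenius R p) W.le_comap_map = frobenius T p :=
    IsLocalization.ringHom_ext W <| RingHom.ext fun r => by simp [frobenius_def]
  rw [IsFFinite, ← hmap]
  exact RingHom.finite_localizationPreserves _ W T T hR

theorem finite_iterateFrobenius {p : ℕ} {R : Type*} [CommRing R] [ExpChar R p]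
    (hR : IsFFinite p R) (e : ℕ) : (iterateFrobenius R p e).Finite := by
  induction e with
  | zero => simpa only [iterateFrobenius_zero] using RingHom.Finite.id R
  | succ e ih =>
    rw [iterateFrobenius_add, iterateFrobenius_one]
    exact ih.comp hR

theorem comap_frobenius_eq_self (p : ℕ) {R : Type*} [CommRing R] [ExpChar R p] (P : Ideal R)
    [P.IsPrime] : P.comap (frobenius R p) = P := by
  ext x
  rw [Ideal.mem_comap, frobenius_def, Ideal.IsPrime.pow_mem_iff_mem ‹_› p (expChar_pos R p)]

section Prime

variable {p : ℕ} [Fact p.Prime] {R : Type*} [CommRing R] [CharP R p]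

theorem charP_of_algebra (T : Type*) [CommRing T] [Nontrivial T] [Algebra R T] : CharP T p :=
  (CharP.charP_iff_prime_eq_zero Fact.out).2 <| by
    rw [← map_natCast (algebraMap R T), CharP.cast_eq_zero, map_zero]

variable [IsRegularRing R]

theorem flat_localRingHom_frobenius (hR : IsFFinite p R) {P Q : Ideal R} [P.IsPrime] [Q.IsPrime]
    (hQ : Q = P.comap (frobenius R p)) :
    (Localization.localRingHom Q P (frobenius R p) hQ).Flat := by
  obtain rfl : Q = P := hQ.trans (comap_frobenius_eq_self p P)
  have : CharP (Localization.AtPrime Q) p := charP_of_algebra (R := R) _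
  have hmap : Localization.localRingHom Q Q (frobenius R p) hQ =
      frobenius (Localization.AtPrime Q) p :=
    IsLocalization.ringHom_ext Q.primeCompl <| RingHom.ext fun r => by
      simp [Localization.localRingHom_to_map, frobenius_def]
  rw [hmap]
  exact flat_frobenius_of_isRegularLocalRing p (isFFinite_of_isLocalization Q.primeCompl hR)

theorem flat_frobenius (hR : IsFFinite p R) : (frobenius R p).Flat :=
  RingHom.Flat.ofLocalizationPrime _ fun _ _ => flat_localRingHom_frobenius hR rfl

theorem flat_iterateFrobenius (hR : IsFFinite p R) (e : ℕ) : (iterateFrobenius R p e).Flat := by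
  induction e with
  | zero => simpa only [iterateFrobenius_zero] using RingHom.Flat.id R
  | succ e ih =>
    rw [iterateFrobenius_add, iterateFrobenius_one]
    exact (flat_frobenius hR).comp ih

end Prime

end Frobenius

section DualSystems

theorem exists_dualBasis_of_finite_of_flat {R S : Type*} [CommRing R] [CommRing S]
    [IsNoetherianRing R] {f : R →+* S} (hfin : f.Finite) (hflat : f.Flat) :
    ∃ (n : ℕ) (φ : Fin n → S →+ R) (b : Fin n → S),
      (∀ i r x, φ i (f r * x) = r * φ i x) ∧ ∀ x, x = ∑ i, f (φ i x) * b i := by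
  algebraize [f]
  have := Module.finitePresentation_of_finite R S
  have : Module.Projective R S := Module.Flat.projective_of_finitePresentation
  obtain ⟨n, g, h, -, -, hgh⟩ := Module.Finite.exists_comp_eq_id_of_projective R S
  have smul_eq (r : R) (x : S) : f r * x = r • x := (Algebra.smul_def r x).symm
  refine ⟨n, fun i => ((LinearMap.proj i).comp h).toAddMonoidHom, fun i => g (Pi.single i 1),
    fun i r x => by simp [smul_eq], fun x => ?_⟩
  calc x = g (h x) := (LinearMap.congr_fun hgh x).symm
    _ = g (∑ i, h x i • Pi.single i 1) := by rw [← pi_eq_sum_univ' (h x)]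
    _ = _ := by simp [smul_eq]

/-- A dual system for the `q`-th power map: the maps `φ i` and the elements `b i` exhibit a ring as
a finite projective module over itself by way of `r ↦ r ^ q`. -/
structure IsDualSystem {R ι : Type*} [CommRing R] [Fintype ι] (q : ℕ) (φ : ι → R →+ R)
    (b : ι → R) : Prop where
  map_pow_mul : ∀ i r x, φ i (r ^ q * x) = r * φ i x
  sum_eq : ∀ x, x = ∑ i, φ i x ^ q * b i

/-- A ring is Frobenius projective if every iterate of its Frobenius endomorphism makes it a finite
projective module over itself. By Kunz's theorem this holds for `F`-finite regular rings, and it is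
all that is needed of them to compute Frobenius roots. -/
def IsFrobeniusProjective (p : ℕ) (R : Type*) [CommRing R] : Prop :=
  ∀ e, ∃ (n : ℕ) (φ : Fin n → R →+ R) (b : Fin n → R), IsDualSystem (p ^ e) φ b

theorem isFrobeniusProjective_of_isRegularRing {p : ℕ} [Fact p.Prime] {R : Type*} [CommRing R]
    [IsRegularRing R] [CharP R p] (hR : IsFFinite p R) : IsFrobeniusProjective p R := fun e => by
  obtain ⟨n, φ, b, hφ, hb⟩ := exists_dualBasis_of_finite_of_flat (finite_iterateFrobenius hR e)
    (flat_iterateFrobenius hR e)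
  simp only [iterateFrobenius_def] at hφ hb
  exact ⟨n, φ, b, hφ, hb⟩

end DualSystems

section BracketPow

variable {R : Type*} [CommRing R]

theorem bracketPow_mono {I J : Ideal R} (hIJ : I ≤ J) (q : ℕ) : I.bracketPow q ≤ J.bracketPow q :=
  Ideal.span_mono (Set.image_mono hIJ)

theorem pow_mem_bracketPow {I : Ideal R} {x : R} (hx : x ∈ I) (q : ℕ) : x ^ q ∈ I.bracketPow q :=
  Ideal.subset_span ⟨x, hx, rfl⟩

theorem bracketPow_one (I : Ideal R) : I.bracketPow 1 = I := by
  simp [Ideal.bracketPow]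

theorem bracketRoot_mono {I J : Ideal R} (hIJ : I ≤ J) (q : ℕ) :
    I.bracketRoot q ≤ J.bracketRoot q :=
  sInf_le_sInf fun _ hK => hIJ.trans hK

theorem bracketRoot_bracketPow_le (I : Ideal R) (q : ℕ) : (I.bracketPow q).bracketRoot q ≤ I :=
  sInf_le (le_refl (I.bracketPow q))

theorem map_mem_of_mem_bracketPow {J : Ideal R} {q : ℕ} {φ : R →+ R}
    (hφ : ∀ r x, φ (r ^ q * x) = r * φ x) {x : R} (hx : x ∈ J.bracketPow q) : φ x ∈ J := by
  suffices hmul : ∀ s, φ (s * x) ∈ J by simpa only [one_mul] using hmul 1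
  induction hx using Submodule.span_induction with
  | mem x hx =>
    obtain ⟨f, hf, rfl⟩ := hx
    intro s
    rw [mul_comm, hφ]
    exact J.mul_mem_right _ hf
  | zero => simp
  | add x y _ _ hx hy => exact fun s => by simpa only [mul_add, map_add] using add_mem (hx s) (hy s)
  | smul a x _ hx => exact fun s => by simpa only [smul_eq_mul, ← mul_assoc] using hx (s * a)

section ExpChar

variable (p : ℕ) [ExpChar R p]

theorem bracketPow_eq_map_frobenius (I : Ideal R) : I.bracketPow p = I.map (frobenius R p) := rfl

theorem bracketPow_eq_map_iterateFrobenius (I : Ideal R) (e : ℕ) :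
    I.bracketPow (p ^ e) = I.map (iterateFrobenius R p e) := rfl

theorem bracketPow_bracketPow (I : Ideal R) (d e : ℕ) :
    (I.bracketPow (p ^ d)).bracketPow (p ^ e) = I.bracketPow (p ^ (d + e)) := by
  simp only [bracketPow_eq_map_iterateFrobenius, Ideal.map_map, add_comm d, iterateFrobenius_add]

theorem map_bracketPow {S : Type*} [CommRing S] [ExpChar S p] (f : R →+* S) (I : Ideal R) (e : ℕ) :
    (I.bracketPow (p ^ e)).map f = (I.map f).bracketPow (p ^ e) := by
  simp only [bracketPow_eq_map_iterateFrobenius, Ideal.map_map, RingHom.iterateFrobenius_comm]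

end ExpChar

namespace IsDualSystem

variable {ι : Type*} [Fintype ι] {q : ℕ} {φ : ι → R →+ R} {b : ι → R} (h : IsDualSystem q φ b)
include h

theorem mem_bracketPow_iff {J : Ideal R} {x : R} : x ∈ J.bracketPow q ↔ ∀ i, φ i x ∈ J := by
  refine ⟨fun hx i => map_mem_of_mem_bracketPow (h.map_pow_mul i) hx, fun hx => ?_⟩
  rw [h.sum_eq x]
  exact Ideal.sum_mem _ fun i _ => Ideal.mul_mem_right _ _ (pow_mem_bracketPow (hx i) q)

theorem bracketRoot_le_iff {I J : Ideal R} : I.bracketRoot q ≤ J ↔ I ≤ J.bracketPow q := by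
  refine ⟨fun hIJ => le_trans (fun x hx => ?_) (bracketPow_mono hIJ q), fun hIJ => sInf_le hIJ⟩
  rw [h.mem_bracketPow_iff]
  intro i
  rw [Ideal.bracketRoot, Submodule.mem_sInf]
  exact fun K hK => h.mem_bracketPow_iff.1 (hK hx) i

theorem span_range_apply_one (hq : q ≠ 0) : Ideal.span (Set.range fun i => φ i 1) = ⊤ := by
  have hsum : ∑ i, φ i 1 ^ q * b i ∈ Ideal.span (Set.range fun i => φ i 1) :=
    Ideal.sum_mem _ fun i _ => Ideal.mul_mem_right _ _ <|
      Ideal.pow_mem_of_mem _ (Ideal.subset_span (Set.mem_range_self i)) q (Nat.pos_of_ne_zero hq)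
  rwa [← h.sum_eq 1, ← Ideal.eq_top_iff_one] at hsum

theorem mem_of_pow_mem_bracketPow (hq : q ≠ 0) {J : Ideal R} {x : R}
    (hx : x ^ q ∈ J.bracketPow q) : x ∈ J := by
  have hmul (i : ι) : x * φ i 1 ∈ J := by
    rw [← h.map_pow_mul, mul_one]
    exact h.mem_bracketPow_iff.1 hx i
  have hle : Ideal.span {x} * Ideal.span (Set.range fun i => φ i 1) ≤ J := by
    rw [Ideal.span_mul_span', Set.singleton_mul, Ideal.span_le]
    rintro _ ⟨_, ⟨i, rfl⟩, rfl⟩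
    exact hmul i
  rwa [h.span_range_apply_one hq, Ideal.mul_top, Ideal.span_singleton_le_iff_mem] at hle

end IsDualSystem

end BracketPow

section CoeffIdeal

open MvPolynomial

variable {σ R : Type*} [CommRing R]

/-- The ideal generated by the coefficients of a polynomial. -/
def coeffIdeal (f : MvPolynomial σ R) : Ideal R :=
  Ideal.span (Set.range fun u => f.coeff u)

theorem coeff_mem_coeffIdeal (f : MvPolynomial σ R) (u : σ →₀ ℕ) : f.coeff u ∈ coeffIdeal f :=
  Ideal.subset_span ⟨u, rfl⟩

theorem coeffIdeal_le_iff {f : MvPolynomial σ R} {I : Ideal R} :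
    coeffIdeal f ≤ I ↔ ∀ u, f.coeff u ∈ I := by
  rw [coeffIdeal, Ideal.span_le, Set.range_subset_iff]
  rfl

theorem mem_map_C_iff_coeffIdeal_le {f : MvPolynomial σ R} {I : Ideal R} :
    f ∈ I.map C ↔ coeffIdeal f ≤ I := by
  rw [mem_map_C_iff, coeffIdeal_le_iff]

theorem coeffIdeal_one : coeffIdeal (1 : MvPolynomial σ R) = ⊤ := by
  rw [Ideal.eq_top_iff_one]
  simpa only [coeff_zero_one] using coeff_mem_coeffIdeal (1 : MvPolynomial σ R) 0

theorem coeffIdeal_mul_le (f g : MvPolynomial σ R) :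
    coeffIdeal (f * g) ≤ coeffIdeal f * coeffIdeal g := by
  classical
  refine coeffIdeal_le_iff.2 fun u => ?_
  rw [coeff_mul]
  exact Ideal.sum_mem _ fun x _ =>
    Ideal.mul_mem_mul (coeff_mem_coeffIdeal f _) (coeff_mem_coeffIdeal g _)

theorem coeffIdeal_pderiv_le (f : MvPolynomial σ R) (i : σ) :
    coeffIdeal (pderiv i f) ≤ coeffIdeal f := by
  refine coeffIdeal_le_iff.2 fun u => ?_
  rw [coeff_pderiv]
  exact Ideal.mul_mem_right _ _ (coeff_mem_coeffIdeal f _)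

/-- The `R[z ^ q]`-linear projection of `R[z]` to the component spanned by the monomial `z ^ u`,
with `z ^ q` renamed to `z`; here the entries of `u` are meant to be less than `q`, the projection
being zero otherwise. -/
noncomputable def residueComponent (q : ℕ) (u : σ →₀ ℕ) :
    MvPolynomial σ R →ₗ[R] MvPolynomial σ R :=
  open Classical in
  (basisMonomials σ R).constr R fun w =>
    if w.mapRange (· % q) (Nat.zero_mod q) = u then
      monomial (w.mapRange (· / q) (Nat.zero_div q)) 1 else 0

open Classical in
theorem residueComponent_monomial (q : ℕ) (u w : σ →₀ ℕ) (a : R) :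
    residueComponent q u (monomial w a) = if w.mapRange (· % q) (Nat.zero_mod q) = u then
      monomial (w.mapRange (· / q) (Nat.zero_div q)) a else 0 := by
  have hw : monomial w a = a • basisMonomials σ R w := by simp [smul_monomial]
  rw [hw, map_smul, residueComponent, Module.Basis.constr_basis]
  split_ifs <;> simp [smul_monomial]

theorem residueComponent_expand_mul {q : ℕ} (hq : q ≠ 0) (u : σ →₀ ℕ) (h f : MvPolynomial σ R) :
    residueComponent q u (expand q h * f) = h * residueComponent q u f := by
  classical
  induction h using MvPolynomial.induction_on' with
  | add h₁ h₂ ih₁ ih₂ => rw [map_add, add_mul, map_add, ih₁, ih₂, add_mul]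
  | monomial a α =>
    induction f using MvPolynomial.induction_on' with
    | add f₁ f₂ ih₁ ih₂ => rw [mul_add, map_add, ih₁, ih₂, map_add, mul_add]
    | monomial w β =>
      have hmod : (q • a + w).mapRange (· % q) (Nat.zero_mod q) =
          w.mapRange (· % q) (Nat.zero_mod q) := by
        ext i
        simp
      have hdiv : (q • a + w).mapRange (· / q) (Nat.zero_div q) =
          a + w.mapRange (· / q) (Nat.zero_div q) := by
        ext i
        simp [Nat.mul_add_div (Nat.pos_of_ne_zero hq)]
      rw [expand_monomial, monomial_mul, residueComponent_monomial, residueComponent_monomial,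
        hmod, hdiv, mul_ite, mul_zero, monomial_mul]

theorem residueComponent_eq_C {q : ℕ} {f : MvPolynomial σ R} (hf : ∀ w ∈ f.support, ∀ i, w i < q)
    (u : σ →₀ ℕ) : residueComponent q u f = C (f.coeff u) := by
  classical
  have hmonomial : ∀ w ∈ f.support, residueComponent q u (monomial w (f.coeff w)) =
      if w = u then C (f.coeff w) else 0 := by
    intro w hw
    have hmod : w.mapRange (· % q) (Nat.zero_mod q) = w := by
      ext i
      simpa using Nat.mod_eq_of_lt (hf w hw i)
    have hdiv : w.mapRange (· / q) (Nat.zero_div q) = 0 := by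
      ext i
      simpa using Nat.div_eq_of_lt (hf w hw i)
    rw [residueComponent_monomial, hmod, hdiv]
    rfl
  conv_lhs => rw [f.as_sum, map_sum, Finset.sum_congr rfl hmonomial, Finset.sum_ite_eq']
  split_ifs with hu
  · rfl
  · rw [notMem_support_iff.1 hu, C_0]

theorem coeffIdeal_residueComponent_le (q : ℕ) (u : σ →₀ ℕ) (f : MvPolynomial σ R) :
    coeffIdeal (residueComponent q u f) ≤ coeffIdeal f := by
  classical
  refine coeffIdeal_le_iff.2 fun v => ?_
  rw [f.as_sum, map_sum, coeff_sum, ← f.as_sum]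
  refine Ideal.sum_mem _ fun w _ => ?_
  rw [residueComponent_monomial]
  split_ifs
  · rw [coeff_monomial]
    split_ifs
    · exact coeff_mem_coeffIdeal f w
    · exact zero_mem _
  · exact zero_mem _

section ExpChar

variable (p : ℕ) [ExpChar R p] (e : ℕ)

theorem pow_eq_expand_map (f : MvPolynomial σ R) :
    f ^ p ^ e = expand (p ^ e) (map (iterateFrobenius R p e) f) := by
  have hhom : iterateFrobenius (MvPolynomial σ R) p e =
      (expand (p ^ e) : MvPolynomial σ R →ₐ[R] MvPolynomial σ R).toRingHom.comp
        (map (iterateFrobenius R p e)) :=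
    ringHom_ext (fun r => by simp [iterateFrobenius_def])
      (fun i => by simp [iterateFrobenius_def])
  exact DFunLike.congr_fun hhom f

theorem coeffIdeal_pow_expChar (f : MvPolynomial σ R) :
    coeffIdeal (f ^ p ^ e) = (coeffIdeal f).bracketPow (p ^ e) := by
  classical
  have hq : p ^ e ≠ 0 := pow_ne_zero e (expChar_pos R p).ne'
  have hcoeff (v : σ →₀ ℕ) : (f ^ p ^ e).coeff (p ^ e • v) = f.coeff v ^ p ^ e := by
    rw [pow_eq_expand_map, coeff_expand_smul _ hq, coeff_map, iterateFrobenius_def]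
  refine le_antisymm (coeffIdeal_le_iff.2 fun u => ?_) ?_
  · by_cases hu : u ∈ (f ^ p ^ e).support
    · rw [pow_eq_expand_map, support_expand _ hq, Finset.mem_image] at hu
      obtain ⟨v, -, rfl⟩ := hu
      exact hcoeff v ▸ pow_mem_bracketPow (coeff_mem_coeffIdeal f v) _
    · exact notMem_support_iff.1 hu ▸ zero_mem _
  · rw [bracketPow_eq_map_iterateFrobenius, coeffIdeal, Ideal.map_span, Ideal.span_le]
    rintro _ ⟨_, ⟨v, rfl⟩, rfl⟩
    have hmem := coeff_mem_coeffIdeal (f ^ p ^ e) (p ^ e • v)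
    rwa [hcoeff, ← iterateFrobenius_def] at hmem

theorem coeffIdeal_mul_pow_expChar {f : MvPolynomial σ R}
    (hf : ∀ u ∈ f.support, ∀ i, u i < p ^ e) (g : MvPolynomial σ R) :
    coeffIdeal (f * g ^ p ^ e) = coeffIdeal f * (coeffIdeal g).bracketPow (p ^ e) := by
  refine le_antisymm ((coeffIdeal_mul_le _ _).trans (by rw [coeffIdeal_pow_expChar])) ?_
  rw [bracketPow_eq_map_iterateFrobenius, coeffIdeal, coeffIdeal, Ideal.map_span,
    Ideal.span_mul_span', Ideal.span_le]
  rintro _ ⟨_, ⟨u, rfl⟩, _, ⟨_, ⟨v, rfl⟩, rfl⟩, rfl⟩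
  have hcomponent : residueComponent (p ^ e) u (f * g ^ p ^ e) =
      C (f.coeff u) * map (iterateFrobenius R p e) g := by
    rw [mul_comm f, pow_eq_expand_map,
      residueComponent_expand_mul (pow_ne_zero e (expChar_pos R p).ne'), residueComponent_eq_C hf,
      mul_comm]
  have hmem := coeffIdeal_residueComponent_le (p ^ e) u (f * g ^ p ^ e)
    (coeff_mem_coeffIdeal (residueComponent (p ^ e) u (f * g ^ p ^ e)) v)
  rwa [hcomponent, coeff_C_mul, coeff_map] at hmem

/-- Project to the component of the monomial `z ^ u`, then apply `φ` coefficientwise. -/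
theorem exists_addMonoidHom_pow_mul_eq_and_eq_C (u : σ →₀ ℕ) {φ : R →+ R}
    (hφ : ∀ r x, φ (r ^ p ^ e * x) = r * φ x) :
    ∃ Φ : MvPolynomial σ R →+ MvPolynomial σ R, (∀ r x, Φ (r ^ p ^ e * x) = r * Φ x) ∧
      ∀ f : MvPolynomial σ R, (∀ w ∈ f.support, ∀ i, w i < p ^ e) → Φ f = C (φ (f.coeff u)) := by
  classical
  let ψ : MvPolynomial σ R →+ MvPolynomial σ R :=
    .mk' (fun f => AddMonoidAlgebra.map φ f) fun f g => by ext; simp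
  have hψ (f v) : (ψ f).coeff v = φ (f.coeff v) := coeff_addMonoidAlgebraMap φ f v
  refine ⟨ψ.comp (residueComponent (p ^ e) u).toAddMonoidHom, fun r x => ?_, fun f hf => ?_⟩
  · rw [AddMonoidHom.comp_apply, AddMonoidHom.comp_apply, LinearMap.toAddMonoidHom_coe,
      pow_eq_expand_map, residueComponent_expand_mul (pow_ne_zero e (expChar_pos R p).ne')]
    ext v
    rw [hψ, coeff_mul, coeff_mul, map_sum]
    refine Finset.sum_congr rfl fun w _ => ?_
    rw [coeff_map, iterateFrobenius_def, hφ, hψ]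
  · rw [AddMonoidHom.comp_apply, LinearMap.toAddMonoidHom_coe, residueComponent_eq_C hf]
    ext v
    rw [hψ, coeff_C, coeff_C, apply_ite φ, map_zero]

end ExpChar

end CoeffIdeal

namespace IsFrobeniusProjective

variable {p : ℕ} {R : Type*} [CommRing R] (hR : IsFrobeniusProjective p R)
include hR

theorem bracketRoot_le_iff {I J : Ideal R} {e : ℕ} :
    I.bracketRoot (p ^ e) ≤ J ↔ I ≤ J.bracketPow (p ^ e) := by
  obtain ⟨_, _, _, h⟩ := hR e
  exact h.bracketRoot_le_iff

theorem le_bracketPow_bracketRoot (I : Ideal R) (e : ℕ) :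
    I ≤ (I.bracketRoot (p ^ e)).bracketPow (p ^ e) :=
  hR.bracketRoot_le_iff.1 le_rfl

theorem mem_of_pow_mem_bracketPow (hp : p ≠ 0) {J : Ideal R} {x : R} {e : ℕ}
    (hx : x ^ p ^ e ∈ J.bracketPow (p ^ e)) : x ∈ J := by
  obtain ⟨_, _, _, h⟩ := hR e
  exact h.mem_of_pow_mem_bracketPow (pow_ne_zero e hp) hx

end IsFrobeniusProjective

section FrobeniusPowNat

variable {R : Type*} [CommRing R] (p : ℕ)

theorem frobeniusPowNat_zero (I : Ideal R) : I.frobeniusPowNat p 0 = ⊤ := by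
  simp [Ideal.frobeniusPowNat]

variable [Fact p.Prime] [CharP R p] (I : Ideal R)

theorem frobeniusPowNat_eq_mul {k : ℕ} (hk : k ≠ 0) :
    I.frobeniusPowNat p k = I ^ (k % p) * (I.frobeniusPowNat p (k / p)).bracketPow p := by
  have hfrob (J : Ideal R) : J.bracketPow p = Ideal.mapHom (frobenius R p) J := rfl
  rw [Ideal.frobeniusPowNat, Nat.digits_def' (Fact.out : p.Prime).one_lt (Nat.pos_of_ne_zero hk),
    List.length_cons, Finset.prod_range_succ', mul_comm, hfrob, Ideal.frobeniusPowNat, map_prod]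
  congr 1
  · rw [List.getD_cons_zero, pow_zero, bracketPow_one]
  · refine Finset.prod_congr rfl fun i _ => ?_
    rw [← hfrob, List.getD_cons_succ, ← bracketPow_bracketPow p _ i 1, pow_one]

theorem frobeniusPowNat_one : I.frobeniusPowNat p 1 = I := by
  have hp := (Fact.out : p.Prime).one_lt
  rw [frobeniusPowNat_eq_mul p I one_ne_zero, Nat.mod_eq_of_lt hp, Nat.div_eq_of_lt hp,
    frobeniusPowNat_zero, bracketPow_eq_map_frobenius, Ideal.map_top, Ideal.mul_top, pow_one]

theorem frobeniusPowNat_mul_char (k : ℕ) :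
    I.frobeniusPowNat p (k * p) = (I.frobeniusPowNat p k).bracketPow p := by
  rcases eq_or_ne k 0 with rfl | hk
  · rw [zero_mul, frobeniusPowNat_zero, bracketPow_eq_map_frobenius, Ideal.map_top]
  · have hp := (Fact.out : p.Prime)
    rw [frobeniusPowNat_eq_mul p I (mul_ne_zero hk hp.ne_zero), Nat.mul_mod_left, pow_zero, one_mul,
      Nat.mul_div_cancel k hp.pos]

theorem frobeniusPowNat_mul_pow (k d : ℕ) :
    I.frobeniusPowNat p (k * p ^ d) = (I.frobeniusPowNat p k).bracketPow (p ^ d) := by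
  induction d with
  | zero => rw [pow_zero, mul_one, bracketPow_one]
  | succ d ih =>
    rw [pow_succ, ← mul_assoc, frobeniusPowNat_mul_char, ih, ← pow_succ,
      ← bracketPow_bracketPow p _ d 1, pow_one]

theorem frobeniusPowNat_pow (d : ℕ) : I.frobeniusPowNat p (p ^ d) = I.bracketPow (p ^ d) := by
  rw [← one_mul (p ^ d), frobeniusPowNat_mul_pow, frobeniusPowNat_one, one_mul]

end FrobeniusPowNat

section GenericComb

open MvPolynomial

variable {R : Type*} [CommRing R] {m : ℕ} (g : Fin m → R)

theorem totalDegree_genericComb_le : (genericComb g).totalDegree ≤ 1 := by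
  refine totalDegree_finsetSum_le fun i _ => (totalDegree_mul _ _).trans ?_
  rw [totalDegree_C, add_zero]
  exact (totalDegree_monomial_le _ _).trans (Finsupp.degree_single i 1).le

theorem lt_of_mem_support_genericComb_pow {k q : ℕ} (hk : k < q) :
    ∀ u ∈ (genericComb g ^ k).support, ∀ i, u i < q := fun u hu i =>
  calc u i ≤ u.degree := Finsupp.le_degree i u
    _ ≤ (genericComb g ^ k).totalDegree := le_totalDegree hu
    _ ≤ k * (genericComb g).totalDegree := totalDegree_pow _ _
    _ ≤ k * 1 := Nat.mul_le_mul_left k (totalDegree_genericComb_le g)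
    _ < q := by omega

theorem coeffIdeal_genericComb_le : coeffIdeal (genericComb g) ≤ Ideal.span (Set.range g) := by
  refine coeffIdeal_le_iff.2 fun u => ?_
  rw [genericComb, coeff_sum]
  refine Ideal.sum_mem _ fun i _ => ?_
  rw [mul_comm, coeff_C_mul]
  exact Ideal.mul_mem_right _ _ (Ideal.subset_span ⟨i, rfl⟩)

theorem pderiv_genericComb (i : Fin m) : pderiv i (genericComb g) = C (g i) := by
  classical
  simp [genericComb, Pi.single_apply]

variable (p : ℕ) [Fact p.Prime] [CharP R p]

/-- Differentiating the `(k + 1)`-st power with respect to `zᵢ` multiplies the `k`-th one by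
`(k + 1) gᵢ`, where `k + 1` is invertible as long as `k + 1 < p`. -/
theorem coeffIdeal_genericComb_pow_of_lt {k : ℕ} (hk : k < p) :
    coeffIdeal (genericComb g ^ k) = Ideal.span (Set.range g) ^ k := by
  induction k with
  | zero => rw [pow_zero, pow_zero, Ideal.one_eq_top, coeffIdeal_one]
  | succ k ih =>
    specialize ih (by omega)
    refine le_antisymm ?_ ?_
    · rw [pow_succ, pow_succ, ← ih]
      exact (coeffIdeal_mul_le _ _).trans (Ideal.mul_mono_right (coeffIdeal_genericComb_le g))
    · rw [pow_succ', ← ih, coeffIdeal, Ideal.span_mul_span', Ideal.span_le]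
      rintro _ ⟨_, ⟨i, rfl⟩, _, ⟨u, rfl⟩, rfl⟩
      have hunit : IsUnit ((k + 1 : ℕ) : R) :=
        (CharP.isUnit_natCast_iff Fact.out).2 (Nat.not_dvd_of_pos_of_lt k.succ_pos hk)
      have hpderiv : pderiv i (genericComb g ^ (k + 1)) =
          C (((k + 1 : ℕ) : R) * g i) * genericComb g ^ k := by
        rw [pderiv_pow, pderiv_genericComb, Nat.add_sub_cancel, C_mul, map_natCast]
        ring
      have hmem := coeffIdeal_pderiv_le (genericComb g ^ (k + 1)) i (coeff_mem_coeffIdeal _ u)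
      rw [hpderiv, coeff_C_mul, mul_assoc] at hmem
      exact (Ideal.unit_mul_mem_iff_mem _ hunit).1 hmem

theorem coeffIdeal_genericComb_pow (k : ℕ) :
    coeffIdeal (genericComb g ^ k) = (Ideal.span (Set.range g)).frobeniusPowNat p k := by
  have hp := (Fact.out : p.Prime)
  induction k using Nat.strong_induction_on with
  | _ k ih =>
    rcases eq_or_ne k 0 with rfl | hk
    · rw [pow_zero, coeffIdeal_one, frobeniusPowNat_zero]
    · have hsupport : ∀ u ∈ (genericComb g ^ (k % p)).support, ∀ i, u i < p ^ 1 :=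
        lt_of_mem_support_genericComb_pow g (by simpa only [pow_one] using Nat.mod_lt k hp.pos)
      calc coeffIdeal (genericComb g ^ k)
          = coeffIdeal (genericComb g ^ (k % p) * (genericComb g ^ (k / p)) ^ p ^ 1) := by
            rw [pow_one, ← pow_mul, ← pow_add, mul_comm (k / p), Nat.mod_add_div]
        _ = coeffIdeal (genericComb g ^ (k % p)) *
              (coeffIdeal (genericComb g ^ (k / p))).bracketPow p := by
            rw [coeffIdeal_mul_pow_expChar p 1 hsupport, pow_one]
        _ = (Ideal.span (Set.range g)).frobeniusPowNat p k := by
            rw [coeffIdeal_genericComb_pow_of_lt g p (Nat.mod_lt k hp.pos),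
              ih _ (Nat.div_lt_self (Nat.pos_of_ne_zero hk) hp.one_lt),
              ← frobeniusPowNat_eq_mul p _ hk]

end GenericComb

section Monotonicity

variable {p : ℕ} [Fact p.Prime] {R : Type*} [CommRing R] [CharP R p] {I : Ideal R}

/-- In terms of the digits this is not obvious; but for `k ≤ l` the `k`-th power of a generic linear
combination of the generators of `I` divides the `l`-th one. -/
theorem frobeniusPowNat_le_of_le (hI : I.FG) {k l : ℕ} (hkl : k ≤ l) :
    I.frobeniusPowNat p l ≤ I.frobeniusPowNat p k := by
  obtain ⟨m, g, rfl⟩ := Submodule.fg_iff_exists_fin_generating_family.1 hI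
  change (Ideal.span _).frobeniusPowNat p l ≤ (Ideal.span _).frobeniusPowNat p k
  rw [← coeffIdeal_genericComb_pow, ← coeffIdeal_genericComb_pow, ← Nat.add_sub_of_le hkl, pow_add]
  exact (coeffIdeal_mul_le _ _).trans Ideal.mul_le_left

theorem frobeniusPowRat_le_of_le (hR : IsFrobeniusProjective p R) (hI : I.FG) {k l e d : ℕ}
    (hl : l ≤ k * p ^ d) : I.frobeniusPowRat p k e ≤ I.frobeniusPowRat p l (e + d) := by
  refine hR.bracketRoot_le_iff.2 fun x hx => ?_
  refine hR.mem_of_pow_mem_bracketPow (Fact.out : p.Prime).ne_zero (e := d) ?_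
  rw [bracketPow_bracketPow]
  refine hR.le_bracketPow_bracketRoot _ _ (frobeniusPowNat_le_of_le hI hl ?_)
  rw [frobeniusPowNat_mul_pow]
  exact pow_mem_bracketPow hx _

end Monotonicity

section RealExponents

theorem eventually_ceil_pow_mul_lt {p : ℕ} (hp : 1 < p) {t : ℝ≥0} (ht : t < 1) :
    ∀ᶠ e in Filter.atTop, ⌈(p : ℝ≥0) ^ e * t⌉₊ < p ^ e := by
  have hp' : (1 : ℝ) < p := by exact_mod_cast hp
  have ht' : (0 : ℝ) < 1 - t := sub_pos.2 (by exact_mod_cast ht)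
  filter_upwards [((tendsto_pow_atTop_atTop_of_one_lt hp').atTop_mul_const ht').eventually_gt_atTop
    1] with e he
  have hceil : (⌈(p : ℝ≥0) ^ e * t⌉₊ : ℝ) < (p : ℝ) ^ e * t + 1 := by
    exact_mod_cast Nat.ceil_lt_add_one (zero_le : 0 ≤ (p : ℝ≥0) ^ e * t)
  have hlt : (⌈(p : ℝ≥0) ^ e * t⌉₊ : ℝ) < (p : ℝ) ^ e := by linarith
  exact_mod_cast hlt

variable (p : ℕ) {R : Type*} [CommRing R]

theorem pow_le_ceil_pow_mul {t : ℝ≥0} (ht : 1 ≤ t) (e : ℕ) :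
    p ^ e ≤ ⌈(p : ℝ≥0) ^ e * t⌉₊ := by
  have hle : (p : ℝ≥0) ^ e ≤ (p : ℝ≥0) ^ e * t := le_mul_of_one_le_right zero_le ht
  exact_mod_cast hle.trans (Nat.le_ceil _)

theorem frobeniusPow_le_of_one_le [Fact p.Prime] [CharP R p] {I : Ideal R} (hI : I.FG) {t : ℝ≥0}
    (ht : 1 ≤ t) : I.frobeniusPow p t ≤ I := by
  refine iSup_le fun e => ?_
  refine (bracketRoot_mono (frobeniusPowNat_le_of_le hI (pow_le_ceil_pow_mul p ht e)) _).trans ?_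
  rw [frobeniusPowNat_pow]
  exact bracketRoot_bracketPow_le _ _

theorem testIdeal_span_singleton_le_of_one_le (x : R) {t : ℝ≥0} (ht : 1 ≤ t) :
    (Ideal.span {x}).testIdeal p t ≤ Ideal.span {x} := by
  refine iSup_le fun e => ?_
  refine (bracketRoot_mono (Ideal.pow_le_pow_right (pow_le_ceil_pow_mul p ht e)) _).trans
    (sInf_le ?_)
  rw [Set.mem_ofPred_eq, Ideal.span_singleton_pow, Ideal.span_singleton_le_iff_mem]
  exact pow_mem_bracketPow (Ideal.mem_span_singleton_self x) _

end RealExponents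

section Localization

open MvPolynomial

theorem algebraMap_mem_of_mem_bracketPow {p e : ℕ} {A T : Type*} [CommRing A] [CommRing T]
    [ExpChar A p] [ExpChar T p] [Algebra A T] (W : Submonoid A) [IsLocalization W T] {Φ : A →+ A}
    (hΦ : ∀ r x, Φ (r ^ p ^ e * x) = r * Φ x) {J : Ideal T} {x : A}
    (hx : algebraMap A T x ∈ J.bracketPow (p ^ e)) : algebraMap A T (Φ x) ∈ J := by
  have hJ : (J.comap (algebraMap A T)).map (algebraMap A T) = J := IsLocalization.map_under W T J
  rw [← hJ, ← map_bracketPow, IsLocalization.algebraMap_mem_map_algebraMap_iff W] at hx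
  obtain ⟨c, hc, hcx⟩ := hx
  have hpow : c ^ p ^ e * x ∈ (J.comap (algebraMap A T)).bracketPow (p ^ e) := by
    rw [← pow_sub_one_mul (pow_ne_zero e (expChar_pos A p).ne') c, mul_assoc]
    exact Ideal.mul_mem_left _ _ hcx
  have hmem := map_mem_of_mem_bracketPow hΦ hpow
  rw [hΦ, Ideal.mem_comap, map_mul] at hmem
  exact (Ideal.unit_mul_mem_iff_mem _ (IsLocalization.map_units T ⟨c, hc⟩)).1 hmem

variable {p : ℕ} [Fact p.Prime] {R : Type*} [CommRing R] [CharP R p] {m : ℕ} (g : Fin m → R)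
  (T : Type*) [CommRing T] [Algebra R T] [Algebra (MvPolynomial (Fin m) R) T]
  [IsScalarTower R (MvPolynomial (Fin m) R) T]

theorem algebraMap_genericComb_pow_mem (k : ℕ) :
    algebraMap (MvPolynomial (Fin m) R) T (genericComb g) ^ k ∈
      ((Ideal.span (Set.range g)).frobeniusPowNat p k).map (algebraMap R T) := by
  rw [IsScalarTower.algebraMap_eq R (MvPolynomial (Fin m) R) T, ← Ideal.map_map, ← map_pow,
    ← coeffIdeal_genericComb_pow]
  exact Ideal.mem_map_of_mem _ (mem_map_C_iff_coeffIdeal_le.2 le_rfl)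

variable [ExpChar T p] (hR : IsFrobeniusProjective p R)

include hR in
theorem bracketRoot_span_genericComb_pow_le (k e : ℕ) :
    (Ideal.span {algebraMap (MvPolynomial (Fin m) R) T (genericComb g)} ^ k).bracketRoot (p ^ e) ≤
      ((Ideal.span (Set.range g)).frobeniusPowRat p k e).map (algebraMap R T) := by
  refine sInf_le ?_
  rw [Set.mem_ofPred_eq, Ideal.span_singleton_pow, Ideal.span_singleton_le_iff_mem,
    ← map_bracketPow]
  exact Ideal.map_mono (hR.le_bracketPow_bracketRoot _ _) (algebraMap_genericComb_pow_mem g T k)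

variable (W : Submonoid (MvPolynomial (Fin m) R)) [IsLocalization W T]

include hR W in
theorem frobeniusPowNat_le_comap_of_genericComb_pow_mem {e k : ℕ} (hk : k < p ^ e) {J : Ideal T}
    (hJ : algebraMap (MvPolynomial (Fin m) R) T (genericComb g) ^ k ∈ J.bracketPow (p ^ e)) :
    (Ideal.span (Set.range g)).frobeniusPowNat p k ≤
      (J.comap (algebraMap R T)).bracketPow (p ^ e) := by
  obtain ⟨_, φ, b, h⟩ := hR e
  rw [← coeffIdeal_genericComb_pow, coeffIdeal_le_iff]
  refine fun u => h.mem_bracketPow_iff.2 fun i => ?_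
  obtain ⟨Φ, hΦ, hΦC⟩ := exists_addMonoidHom_pow_mul_eq_and_eq_C p e u (h.map_pow_mul i)
  rw [← map_pow] at hJ
  have hmem := algebraMap_mem_of_mem_bracketPow W hΦ hJ
  rwa [hΦC _ (lt_of_mem_support_genericComb_pow g hk), ← algebraMap_eq,
    ← IsScalarTower.algebraMap_apply] at hmem

include hR W in
theorem bracketRoot_span_genericComb_pow {k e : ℕ} (hk : k < p ^ e) :
    (Ideal.span {algebraMap (MvPolynomial (Fin m) R) T (genericComb g)} ^ k).bracketRoot (p ^ e) =
      ((Ideal.span (Set.range g)).frobeniusPowRat p k e).map (algebraMap R T) := by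
  refine (bracketRoot_span_genericComb_pow_le g T hR k e).antisymm (le_sInf fun J hJ => ?_)
  rw [Set.mem_ofPred_eq, Ideal.span_singleton_pow, Ideal.span_singleton_le_iff_mem] at hJ
  exact Ideal.map_le_iff_le_comap.2 <| hR.bracketRoot_le_iff.2 <|
    frobeniusPowNat_le_comap_of_genericComb_pow_mem g T hR W hk hJ

include hR W in
theorem testIdeal_span_genericComb {t : ℝ≥0} (ht : t < 1) :
    (Ideal.span {algebraMap (MvPolynomial (Fin m) R) T (genericComb g)}).testIdeal p t =
      ((Ideal.span (Set.range g)).frobeniusPow p t).map (algebraMap R T) := by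
  rw [Ideal.testIdeal, Ideal.frobeniusPow, Ideal.map_iSup]
  refine le_antisymm (iSup_mono fun e => bracketRoot_span_genericComb_pow_le g T hR _ e)
    (iSup_le fun e => ?_)
  obtain ⟨_, hlt, hle⟩ := ((eventually_ceil_pow_mul_lt (Fact.out : p.Prime).one_lt ht).and
    (Filter.eventually_ge_atTop e)).exists
  obtain ⟨d, rfl⟩ := Nat.exists_eq_add_of_le hle
  refine le_trans ?_ (le_iSup _ (e + d))
  rw [bracketRoot_span_genericComb_pow g T hR W hlt]
  refine Ideal.map_mono (frobeniusPowRat_le_of_le hR (Submodule.fg_span (Set.finite_range g)) ?_)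
  rw [Nat.ceil_le, pow_add, mul_right_comm]
  push_cast
  gcongr
  exact Nat.le_ceil _

include hR W in
theorem lce_eq_fpt_span_genericComb [Module.FaithfullyFlat R T]
    (hg : Ideal.span (Set.range g) ≠ ⊤) :
    (Ideal.span (Set.range g)).lce p =
      (Ideal.span {algebraMap (MvPolynomial (Fin m) R) T (genericComb g)}).fpt p := by
  have hG : algebraMap (MvPolynomial (Fin m) R) T (genericComb g) ∈
      (Ideal.span (Set.range g)).map (algebraMap R T) := by
    simpa only [pow_one, frobeniusPowNat_one] using
      algebraMap_genericComb_pow_mem (p := p) g T 1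
  have hmap (I : Ideal R) : I.map (algebraMap R T) = ⊤ ↔ I = ⊤ :=
    ⟨fun hI => by rw [← I.comap_map_eq_self_of_faithfullyFlat (B := T), hI, Ideal.comap_top],
      fun hI => by rw [hI, Ideal.map_top]⟩
  have hiff (t : ℝ≥0) : (Ideal.span (Set.range g)).frobeniusPow p t = ⊤ ↔
      (Ideal.span {algebraMap (MvPolynomial (Fin m) R) T (genericComb g)}).testIdeal p t = ⊤ := by
    obtain ht | ht := lt_or_ge t 1
    · rw [testIdeal_span_genericComb g T hR W ht, hmap]
    · have hfrobenius := frobeniusPow_le_of_one_le p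
        (Submodule.fg_span (R := R) (Set.finite_range g)) ht
      have htest := (testIdeal_span_singleton_le_of_one_le p _ ht).trans <|
        (Ideal.span_singleton_le_iff_mem _).2 hG
      exact iff_of_false (fun h => hg (top_le_iff.1 (h ▸ hfrobenius)))
        fun h => hg ((hmap _).1 (top_le_iff.1 (h ▸ htest)))
  simp only [Ideal.lce, Ideal.fpt, hiff]

end Localization

section Pushout

open MvPolynomial

theorem faithfullyFlat_of_isPushout (k R K T : Type*) [CommRing k] [CommRing R] [CommRing K]
    [CommRing T] [Algebra k R] [Algebra k K] [Algebra k T] [Algebra R T] [Algebra K T]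
    [IsScalarTower k R T] [IsScalarTower k K T] [Algebra.IsPushout k R K T]
    [Module.FaithfullyFlat k K] : Module.FaithfullyFlat R T :=
  Module.FaithfullyFlat.of_linearEquiv R (R ⊗[k] K)
    (Algebra.IsPushout.equiv k R K T).symm.toLinearEquiv

attribute [local instance] MvPolynomial.algebraMvPolynomial in
theorem isLocalization_map_of_isPushout {σ k R K T : Type*} [CommRing k] [CommRing R] [CommRing K]
    [CommRing T] [Algebra k R] [Algebra k K] [Algebra k T] [Algebra R T] [Algebra K T]
    [IsScalarTower k R T] [IsScalarTower k K T] [Algebra.IsPushout k R K T]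
    [Algebra (MvPolynomial σ k) K] [IsScalarTower k (MvPolynomial σ k) K]
    [Algebra (MvPolynomial σ R) T] [IsScalarTower R (MvPolynomial σ R) T]
    (hX : ∀ i : σ, algebraMap (MvPolynomial σ R) T (X i) =
      algebraMap K T (algebraMap (MvPolynomial σ k) K (X i)))
    (W : Submonoid (MvPolynomial σ k)) [IsLocalization W K] :
    IsLocalization (W.map (map (algebraMap k R))) T := by
  have hcomm : (algebraMap (MvPolynomial σ R) T).comp
      (algebraMap (MvPolynomial σ k) (MvPolynomial σ R)) =
        (algebraMap K T).comp (algebraMap (MvPolynomial σ k) K) := by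
    refine ringHom_ext (fun c => ?_) fun i => ?_
    · rw [RingHom.comp_apply, RingHom.comp_apply, algebraMap_def, map_C, ← algebraMap_eq,
        ← algebraMap_eq, ← IsScalarTower.algebraMap_apply R (MvPolynomial σ R) T,
        ← IsScalarTower.algebraMap_apply k R T,
        ← IsScalarTower.algebraMap_apply k (MvPolynomial σ k) K,
        ← IsScalarTower.algebraMap_apply k K T]
    · simp [hX]
  let : Algebra (MvPolynomial σ k) T :=
    ((algebraMap K T).comp (algebraMap (MvPolynomial σ k) K)).toAlgebra
  have : IsScalarTower (MvPolynomial σ k) K T := .of_algebraMap_eq' rfl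
  have : IsScalarTower (MvPolynomial σ k) (MvPolynomial σ R) T := .of_algebraMap_eq' hcomm.symm
  have : IsScalarTower k (MvPolynomial σ R) T := .to₁₃₄ k R (MvPolynomial σ R) T
  exact (Algebra.isLocalization_iff_isPushout W K).2 <| .symm <|
    (Algebra.IsPushout.comp_iff k (MvPolynomial σ k) R (MvPolynomial σ R) (T := K)).1 <|
      .symm inferInstance

variable (k R : Type*) [Field k] [CommRing R] [Algebra k R] (m : ℕ) (T : Type*) [CommRing T]
  [Algebra k T] [Algebra R T] [Algebra (RatFunField m k) T] [IsScalarTower k R T]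
  [IsScalarTower k (RatFunField m k) T] [Algebra.IsPushout k R (RatFunField m k) T]

theorem exists_isLocalization_algebraMap_genericComb :
    ∃ (_ : Algebra (MvPolynomial (Fin m) R) T) (_ : IsScalarTower R (MvPolynomial (Fin m) R) T)
      (W : Submonoid (MvPolynomial (Fin m) R)), IsLocalization W T ∧
      ∀ g : Fin m → R, algebraMap (MvPolynomial (Fin m) R) T (genericComb g) =
        ∑ i, algebraMap (RatFunField m k) T (ratVar k i) * algebraMap R T (g i) := by
  let f : MvPolynomial (Fin m) R →ₐ[R] T :=
    aeval fun i => algebraMap (RatFunField m k) T (ratVar k i)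
  let := f.toAlgebra
  have hX (i : Fin m) : algebraMap (MvPolynomial (Fin m) R) T (X i) =
      algebraMap (RatFunField m k) T (ratVar k i) := aeval_X _ i
  have : IsScalarTower R (MvPolynomial (Fin m) R) T :=
    .of_algebraMap_eq fun r => (f.commutes r).symm
  refine ⟨_, this, _, isLocalization_map_of_isPushout hX (nonZeroDivisors _), fun g => ?_⟩
  rw [genericComb, map_sum]
  refine Finset.sum_congr rfl fun i _ => ?_
  rw [map_mul, hX, ← algebraMap_eq, ← IsScalarTower.algebraMap_apply]

variable {p : ℕ} [Fact p.Prime] [CharP R p] (hR : IsFrobeniusProjective p R) {m} (g : Fin m → R)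
include hR

theorem testIdeal_span_sum_ratVar_of_isPushout {t : ℝ≥0} (ht : t < 1) :
    (Ideal.span {∑ i, algebraMap (RatFunField m k) T (ratVar k i) *
      algebraMap R T (g i)}).testIdeal p t =
        ((Ideal.span (Set.range g)).frobeniusPow p t).map (algebraMap R T) := by
  obtain ⟨_, _, W, _, hG⟩ := exists_isLocalization_algebraMap_genericComb k R m T
  have := faithfullyFlat_of_isPushout k R (RatFunField m k) T
  have := charP_of_injective_algebraMap (FaithfulSMul.algebraMap_injective R T) p
  rw [← hG, testIdeal_span_genericComb g T hR W ht]

theorem lce_eq_fpt_span_sum_ratVar_of_isPushout (hg : Ideal.span (Set.range g) ≠ ⊤) :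
    (Ideal.span (Set.range g)).lce p =
      (Ideal.span {∑ i, algebraMap (RatFunField m k) T (ratVar k i) *
        algebraMap R T (g i)}).fpt p := by
  obtain ⟨_, _, W, _, hG⟩ := exists_isLocalization_algebraMap_genericComb k R m T
  have := faithfullyFlat_of_isPushout k R (RatFunField m k) T
  have := charP_of_injective_algebraMap (FaithfulSMul.algebraMap_injective R T) p
  rw [← hG, lce_eq_fpt_span_genericComb g T hR W hg]

end Pushout

theorem isFFinite_mvPolynomial {p : ℕ} {σ R : Type*} [Finite σ] [CommRing R] [ExpChar R p]
    (hR : IsFFinite p R) : IsFFinite p (MvPolynomial σ R) := by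
  have hcomm : (frobenius (MvPolynomial σ R) p).comp MvPolynomial.C =
      (MvPolynomial.C : R →+* MvPolynomial σ R).comp (frobenius R p) :=
    RingHom.ext fun x => by simp [frobenius_def]
  have hC : (MvPolynomial.C : R →+* MvPolynomial σ R).FiniteType :=
    RingHom.finiteType_algebraMap.2 inferInstance
  have hfiniteType : (frobenius (MvPolynomial σ R) p).FiniteType :=
    .of_comp_finiteType (f := MvPolynomial.C) (hcomm ▸ hC.comp hR.finiteType)
  refine RingHom.IsIntegral.to_finite (fun f => ?_) hfiniteType
  refine ⟨Polynomial.X ^ p - Polynomial.C f,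
    Polynomial.monic_X_pow_sub_C f (expChar_pos R p).ne', ?_⟩
  simp [frobenius_def]

attribute [local instance] Algebra.TensorProduct.rightAlgebra MvPolynomial.algebraMvPolynomial in
theorem mainTheorem2_general (p : ℕ) [Fact p.Prime] :
    (∀ (R : Type*) [CommRing R] [IsRegularRing R] [CharP R p], IsFFinite p R →
      ∀ (m : ℕ) (g : Fin m → R), Ideal.span (Set.range g) ≠ ⊤ →
        (Ideal.span (Set.range g)).lce p = (Ideal.span {genericComb g}).fpt p ∧
        ∀ (k : Type*) [Field k] [Algebra k R],
          (Ideal.span (Set.range g)).lce p = (Ideal.span {genericCombTensor k g}).fpt p) ∧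
    (∀ (k : Type*) [Field k] [CharP k p], IsFFinite p k →
      ∀ (m n : ℕ) (g : Fin m → MvPolynomial (Fin n) k),
        (∀ t : ℝ≥0, t < 1 →
          (Ideal.span {genericCombPoly g}).testIdeal p t =
            ((Ideal.span (Set.range g)).frobeniusPow p t).map (polyIncl k m n) ∧
          (Ideal.span (Set.range g)).frobeniusPow p t =
            ((Ideal.span {genericCombPoly g}).testIdeal p t).comap (polyIncl k m n)) ∧
        (Ideal.span (Set.range g) ≠ ⊤ →
          (Ideal.span {genericCombPoly g}).fpt p = (Ideal.span (Set.range g)).lce p)) := by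
  refine ⟨fun R _ _ _ hR m g hg => ?_, fun k _ _ hk m n g => ?_⟩
  · have hproj := isFrobeniusProjective_of_isRegularRing hR
    have := CharP.nontrivial_of_char_ne_one (R := R) (Fact.out : p.Prime).ne_one
    refine ⟨lce_eq_fpt_span_genericComb g _ hproj (IsUnit.submonoid _) hg, fun k _ _ => ?_⟩
    have hG : genericCombTensor k g = ∑ i, algebraMap (RatFunField m k) (R ⊗[k] RatFunField m k)
        (ratVar k i) * algebraMap R _ (g i) := by
      simp [genericCombTensor, Algebra.TensorProduct.right_algebraMap_apply]
    rw [hG, ← lce_eq_fpt_span_sum_ratVar_of_isPushout k R _ hproj g hg]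
  · have hproj := isFrobeniusProjective_of_isRegularRing (isFFinite_mvPolynomial (σ := Fin n) hk)
    have htest {t : ℝ≥0} (ht : t < 1) : (Ideal.span {genericCombPoly g}).testIdeal p t =
        ((Ideal.span (Set.range g)).frobeniusPow p t).map (polyIncl k m n) :=
      testIdeal_span_sum_ratVar_of_isPushout k _ _ hproj g ht
    have := faithfullyFlat_of_isPushout k (MvPolynomial (Fin n) k) (RatFunField m k)
      (MvPolynomial (Fin n) (RatFunField m k))
    exact ⟨fun t ht => ⟨htest ht, htest ht ▸ (Ideal.comap_map_eq_self_of_faithfullyFlat _).symm⟩,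
      fun hg => (lce_eq_fpt_span_sum_ratVar_of_isPushout k _ _ hproj g hg).symm⟩

theorem mainTheorem2 (p : ℕ) [Fact p.Prime] :
    -- an arbitrary `F`-finite regular domain `R`, with `G` in `R[z]` or in `R ⊗ₖ k(z)`
    (∀ (R : Type*) [CommRing R] [IsDomain R] [IsRegularRing R] [CharP R p], IsFFinite p R →
      ∀ (m : ℕ) (g : Fin m → R),
        Ideal.span (Set.range g) ≠ ⊥ → Ideal.span (Set.range g) ≠ ⊤ →
        (Ideal.span (Set.range g)).lce p = (Ideal.span {genericComb g}).fpt p ∧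
        ∀ (k : Type*) [Field k] [CharP k p] [Algebra k R], IsFFinite p k →
          (Ideal.span (Set.range g)).lce p = (Ideal.span {genericCombTensor k g}).fpt p) ∧
    -- a polynomial ring `k[x]`, with `G` in `k(z)[x]`
    (∀ (k : Type*) [Field k] [CharP k p], IsFFinite p k →
      ∀ (m n : ℕ) (g : Fin m → MvPolynomial (Fin n) k),
        (∀ t : ℝ≥0, 0 < t → t < 1 →
          (Ideal.span {genericCombPoly g}).testIdeal p t =
            ((Ideal.span (Set.range g)).frobeniusPow p t).map (polyIncl k m n) ∧
          (Ideal.span (Set.range g)).frobeniusPow p t =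
            ((Ideal.span {genericCombPoly g}).testIdeal p t).comap (polyIncl k m n)) ∧
        (Ideal.span (Set.range g) ≠ ⊥ → Ideal.span (Set.range g) ≠ ⊤ →
          (Ideal.span {genericCombPoly g}).fpt p = (Ideal.span (Set.range g)).lce p)) :=
  (mainTheorem2_general p).imp
    (fun h R _ _ _ _ hR m g _ hg => (h R hR m g hg).imp_right fun hk k _ _ _ _ => hk k)
    (fun h k _ _ hk m n g => (h k hk m n g).imp (fun ht t _ => ht t) fun hg _ => hg)
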